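/- Let $A_1,\dots,A_m$ be positive definite complex $N\times N$ matrices and let $w_1,\dots,w_m>0$ with $\sum_{j=1}^m w_j=1$. For positive semidefinite $A,B$ let $A^{1/2}$ be the positive semidefinite square root and $$d(A,B)=\Bigl[\operatorname{tr}A+\operatorname{tr}B-2\operatorname{tr}\bigl(A^{1/2}BA^{1/2}\bigr)^{1/2}\Bigr]^{1/2}$$ the Bures–Wasserstein distance. Then the function $X\mapsto\sum_{j=1}^m w_j\,d^2(X,A_j)$ has exactly one minimiser $\Omega$ over the positive definite matrices (the Wasserstein barycentre of $A_1,\dots,A_m$ with weights $w_1,\dots,w_m$). For positive definite $A$ put $$K(A)=A^{-1/2}\Bigl(\sum_{j=1}^m w_j\,(A^{1/2}A_jA^{1/2})^{1/2}\Bigr)^2A^{-1/2}.$$ Let $S_0$ be any positive definite $N\times N$ matrix and define $S_{n+1}=K(S_n)$ for $n\ge 0$. Then every $S_n$ is positive definite, and (i) $\lim_{n\to\infty}S_n=\Omega$; (ii) $\operatorname{tr}S_n\le\operatorname{tr}S_{n+1}\le\operatorname{tr}\Omega$ for all $n\ge 1$. -/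

import Mathlib

open scoped MatrixOrder ComplexOrder

noncomputable section

namespace BuresWasserstein

variable {n m : ℕ}

/-- The Bures-Wasserstein distance
`d(A,B) = [tr A + tr B - 2 tr (A^{1/2} B A^{1/2})^{1/2}]^{1/2}` of two positive semidefinite
matrices (`CFC.sqrt` is the unique positive semidefinite square root). -/
def dist (A B : Matrix (Fin n) (Fin n) ℂ) : ℝ :=
  Real.sqrt (A.trace.re + B.trace.re
    - 2 * (CFC.sqrt (CFC.sqrt A * B * CFC.sqrt A)).trace.re)

/-- The variance `V(X) = ∑ w_j d²(X, A_j)`. -/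
def variance (w : Fin m → ℝ) (A : Fin m → Matrix (Fin n) (Fin n) ℂ)
    (X : Matrix (Fin n) (Fin n) ℂ) : ℝ :=
  ∑ j, w j * dist X (A j) ^ 2

/-- `X` is a minimiser of `∑ w_j d²(·, A_j)` over the positive definite matrices. -/
def IsBarycentre (w : Fin m → ℝ) (A : Fin m → Matrix (Fin n) (Fin n) ℂ)
    (X : Matrix (Fin n) (Fin n) ℂ) : Prop :=
  X.PosDef ∧ ∀ Y : Matrix (Fin n) (Fin n) ℂ, Y.PosDef → variance w A X ≤ variance w A Y

/-- The map `K(X) = X^{-1/2} (∑ w_j (X^{1/2} A_j X^{1/2})^{1/2})² X^{-1/2}`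
(on positive definite `X`, where `X^{1/2}` is invertible). -/
def K (w : Fin m → ℝ) (A : Fin m → Matrix (Fin n) (Fin n) ℂ)
    (X : Matrix (Fin n) (Fin n) ℂ) : Matrix (Fin n) (Fin n) ℂ :=
  (CFC.sqrt X)⁻¹ * (∑ j, w j • CFC.sqrt (CFC.sqrt X * A j * CFC.sqrt X)) ^ 2 * (CFC.sqrt X)⁻¹

end BuresWasserstein

end

noncomputable section

namespace BuresWasserstein

open Matrix

variable {n m : ℕ}

/-! Write `T j = transport X (A j)`, `H = ∑ w j T j` and `C = ∑ w j tr (A j)`. Since `T j * X * T j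
= A j`, the fidelity satisfies `2 F(X, A) ≤ tr (X Y) + tr (A Y⁻¹)`, with equality only at `Y = T`;
so a point with `H = 1` is the unique minimiser (`isBarycentre_iff`). Moreover `K X = H * X * H`,
and `F(H X H, T X T) ≥ Re tr (X H T)` gives `V(K X) ≤ C - tr (K X)` (`variance_K_le`). As `V(X) = C
- tr (K X) + tr (X (1 - H)²)`, each step lowers `V` by at least the defect `tr (X (1 - H)²)`, which
therefore tends to `0`; both trace inequalities follow as well. From index 1 on, the iterates lie in
a compact set of positive definite matrices, where the defect is continuous. Hence every cluster
point has `H = 1`, so it is the minimiser and the whole sequence converges to it. -/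

/-! ### Square roots and transport maps. -/

theorem posDef_sqrt {X : Matrix (Fin n) (Fin n) ℂ} (hX : X.PosDef) : (CFC.sqrt X).PosDef := by
  rw [← isStrictlyPositive_iff_posDef] at hX ⊢
  exact hX.sqrt

theorem sqrt_mul_sqrt {X : Matrix (Fin n) (Fin n) ℂ} (hX : X.PosSemidef) :
    CFC.sqrt X * CFC.sqrt X = X :=
  CFC.sqrt_mul_sqrt_self X (nonneg_iff_posSemidef.2 hX)

theorem posDef_conj {X B : Matrix (Fin n) (Fin n) ℂ} (hX : X.PosDef) (hB : B.PosDef) :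
    (B * X * B).PosDef := by
  have h := hX.conjTranspose_mul_mul_same
    (B := B) (mulVec_injective_of_isUnit hB.isUnit)
  rwa [hB.1.eq] at h

/-- The optimal transport map `X^{-1/2} (X^{1/2} A X^{1/2})^{1/2} X^{-1/2}` from `X` to `A`. -/
def transport (X A : Matrix (Fin n) (Fin n) ℂ) : Matrix (Fin n) (Fin n) ℂ :=
  (CFC.sqrt X)⁻¹ * CFC.sqrt (CFC.sqrt X * A * CFC.sqrt X) * (CFC.sqrt X)⁻¹

theorem posDef_transport {X A : Matrix (Fin n) (Fin n) ℂ} (hX : X.PosDef) (hA : A.PosDef) :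
    (transport X A).PosDef :=
  posDef_conj (posDef_sqrt (posDef_conj hA (posDef_sqrt hX))) (posDef_sqrt hX).inv

theorem isUnit_det_sqrt {X : Matrix (Fin n) (Fin n) ℂ} (hX : X.PosDef) :
    IsUnit (CFC.sqrt X).det :=
  (isUnit_iff_isUnit_det _).1 (posDef_sqrt hX).isUnit

theorem inv_sqrt_mul_mul_inv_sqrt {X : Matrix (Fin n) (Fin n) ℂ} (hX : X.PosDef) :
    (CFC.sqrt X)⁻¹ * X * (CFC.sqrt X)⁻¹ = 1 := by
  have h := isUnit_det_sqrt hX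
  nth_rw 2 [← sqrt_mul_sqrt hX.posSemidef]
  rw [nonsing_inv_mul_cancel_left _ _ h, mul_nonsing_inv _ h]

theorem transport_mul_mul_transport {X A : Matrix (Fin n) (Fin n) ℂ} (hX : X.PosDef)
    (hA : A.PosDef) : transport X A * X * transport X A = A := by
  have h := isUnit_det_sqrt hX
  have e := inv_sqrt_mul_mul_inv_sqrt hX
  have e2 := sqrt_mul_sqrt (posDef_conj hA (posDef_sqrt hX)).posSemidef
  unfold transport
  set R := CFC.sqrt X
  set Q := CFC.sqrt (R * A * R)
  calc R⁻¹ * Q * R⁻¹ * X * (R⁻¹ * Q * R⁻¹)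
      = R⁻¹ * Q * (R⁻¹ * X * R⁻¹) * Q * R⁻¹ := by simp only [Matrix.mul_assoc]
    _ = R⁻¹ * (Q * Q) * R⁻¹ := by rw [e]; simp only [Matrix.mul_assoc, Matrix.one_mul]
    _ = (R⁻¹ * R) * A * (R * R⁻¹) := by rw [e2]; simp only [Matrix.mul_assoc]
    _ = A := by rw [nonsing_inv_mul _ h, mul_nonsing_inv _ h, Matrix.one_mul, Matrix.mul_one]

theorem trace_mul_transport {X A : Matrix (Fin n) (Fin n) ℂ} (hX : X.PosDef) :
    (X * transport X A).trace = (CFC.sqrt (CFC.sqrt X * A * CFC.sqrt X)).trace := by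
  have e := inv_sqrt_mul_mul_inv_sqrt hX
  unfold transport
  set R := CFC.sqrt X
  set Q := CFC.sqrt (R * A * R)
  rw [← Matrix.mul_assoc, Matrix.trace_mul_comm, ← Matrix.mul_assoc, ← Matrix.mul_assoc,
    e, Matrix.one_mul]

/-! ### Trace duality for the fidelity. -/

theorem trace_conj_mul_sqrt {X : Matrix (Fin n) (Fin n) ℂ} (hX : X.PosSemidef)
    (P B : Matrix (Fin n) (Fin n) ℂ) :
    ((B * CFC.sqrt X)ᴴ * P * (B * CFC.sqrt X)).trace = (X * (Bᴴ * P * B)).trace := by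
  have hR : (CFC.sqrt X).PosSemidef := nonneg_iff_posSemidef.1 (CFC.sqrt_nonneg X)
  calc ((B * CFC.sqrt X)ᴴ * P * (B * CFC.sqrt X)).trace
      = (CFC.sqrt X * (Bᴴ * P * B) * CFC.sqrt X).trace := by
        rw [conjTranspose_mul, hR.1.eq]; simp only [Matrix.mul_assoc]
    _ = (X * (Bᴴ * P * B)).trace := by rw [trace_mul_cycle, sqrt_mul_sqrt hX]

theorem trace_mul_conj_nonneg {X P : Matrix (Fin n) (Fin n) ℂ} (hX : X.PosSemidef)
    (hP : P.PosSemidef) (B : Matrix (Fin n) (Fin n) ℂ) :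
    0 ≤ (X * (Bᴴ * P * B)).trace.re := by
  have h := (hP.conjTranspose_mul_mul_same (B * CFC.sqrt X)).trace_nonneg
  rw [trace_conj_mul_sqrt hX] at h
  exact (Complex.le_def.1 h).1

theorem eq_zero_of_trace_mul_conj_eq_zero {X P B : Matrix (Fin n) (Fin n) ℂ} (hX : X.PosDef)
    (hP : P.PosDef) (h : (X * (Bᴴ * P * B)).trace.re = 0) : B = 0 := by
  have hp := hP.posSemidef.conjTranspose_mul_mul_same (B * CFC.sqrt X)
  have h0 := hp.trace_nonneg
  have h1 : ((B * CFC.sqrt X)ᴴ * P * (B * CFC.sqrt X)).trace = 0 := by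
    apply Complex.ext
    · rw [trace_conj_mul_sqrt hX.posSemidef, h]; rfl
    · exact (Complex.le_def.1 h0).2.symm
  rw [hp.trace_eq_zero_iff] at h1
  have h2 : CFC.sqrt P * (B * CFC.sqrt X) = 0 := by
    rw [← conjTranspose_mul_self_eq_zero, conjTranspose_mul (CFC.sqrt P), (posDef_sqrt hP).1.eq,
      Matrix.mul_assoc, ← Matrix.mul_assoc (CFC.sqrt P) (CFC.sqrt P),
      sqrt_mul_sqrt hP.posSemidef, ← Matrix.mul_assoc, h1]
  have := congrArg (fun M => (CFC.sqrt P)⁻¹ * M * (CFC.sqrt X)⁻¹) h2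
  simpa [nonsing_inv_mul_cancel_left _ _ (isUnit_det_sqrt hP),
    mul_nonsing_inv_cancel_right _ _ (isUnit_det_sqrt hX)] using this

/-- The fidelity `tr (X^{1/2} A X^{1/2})^{1/2}`. -/
def fidelity (X A : Matrix (Fin n) (Fin n) ℂ) : ℝ :=
  (X * transport X A).trace.re

theorem trace_mul_conj (X C D : Matrix (Fin n) (Fin n) ℂ) :
    (X * (C * D * C)).trace = (C * X * C * D).trace := by
  rw [Matrix.mul_assoc C D, ← Matrix.mul_assoc X, Matrix.trace_mul_comm, Matrix.mul_assoc D,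
    Matrix.trace_mul_comm D, ← Matrix.mul_assoc]

/-- The gap in the duality `2 tr (X T) ≤ tr (X Y) + tr (T X T Y⁻¹)`. -/
theorem trace_dual_gap {X T Y : Matrix (Fin n) (Fin n) ℂ} (hT : T.IsHermitian)
    (hY : Y.PosDef) :
    (X * Y).trace.re + (T * X * T * Y⁻¹).trace.re - 2 * (X * T).trace.re
      = (X * ((Y - T)ᴴ * Y⁻¹ * (Y - T))).trace.re := by
  have hu : IsUnit Y.det := (isUnit_iff_isUnit_det _).1 hY.isUnit
  have e : (Y - T)ᴴ * Y⁻¹ * (Y - T) = Y - T - T + T * Y⁻¹ * T := by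
    rw [conjTranspose_sub, hY.1.eq, hT.eq]
    simp only [Matrix.sub_mul, Matrix.mul_sub]
    rw [mul_nonsing_inv _ hu, Matrix.one_mul, Matrix.mul_assoc T, nonsing_inv_mul _ hu,
      Matrix.mul_one, Matrix.one_mul]
    abel
  rw [e, ← trace_mul_conj]
  simp only [Matrix.mul_add, Matrix.mul_sub, trace_add, trace_sub, Complex.add_re, Complex.sub_re]
  ring

theorem two_mul_fidelity_le {X A Y : Matrix (Fin n) (Fin n) ℂ} (hX : X.PosDef) (hA : A.PosDef)
    (hY : Y.PosDef) : 2 * fidelity X A ≤ (X * Y).trace.re + (A * Y⁻¹).trace.re := by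
  have h := trace_dual_gap (X := X) (posDef_transport hX hA).1 hY
  rw [transport_mul_mul_transport hX hA] at h
  have := trace_mul_conj_nonneg hX.posSemidef hY.inv.posSemidef (Y - transport X A)
  unfold fidelity
  linarith

theorem eq_transport_of_two_mul_fidelity_eq {X A Y : Matrix (Fin n) (Fin n) ℂ} (hX : X.PosDef)
    (hA : A.PosDef) (hY : Y.PosDef)
    (h : 2 * fidelity X A = (X * Y).trace.re + (A * Y⁻¹).trace.re) : Y = transport X A := by
  have h' := trace_dual_gap (X := X) (posDef_transport hX hA).1 hY
  rw [transport_mul_mul_transport hX hA] at h'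
  unfold fidelity at h
  exact sub_eq_zero.1 (eq_zero_of_trace_mul_conj_eq_zero hX hY.inv (by linarith))

theorem trace_mul_inv_transport {X A : Matrix (Fin n) (Fin n) ℂ} (hX : X.PosDef)
    (hA : A.PosDef) : (A * (transport X A)⁻¹).trace.re = fidelity X A := by
  have hu : IsUnit (transport X A).det :=
    (isUnit_iff_isUnit_det _).1 (posDef_transport hX hA).isUnit
  nth_rw 1 [← transport_mul_mul_transport hX hA]
  rw [mul_nonsing_inv_cancel_right _ _ hu, Matrix.trace_mul_comm]
  rfl

/-- The coupling lower bound for the fidelity. -/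
theorem le_fidelity_conj {X H T : Matrix (Fin n) (Fin n) ℂ} (hX : X.PosDef) (hH : H.PosDef)
    (hT : T.PosDef) : (X * H * T).trace.re ≤ fidelity (H * X * H) (T * X * T) := by
  have hB := posDef_conj hX hH
  have hA := posDef_conj hX hT
  have hY := posDef_transport hB hA
  have h1 := trace_mul_inv_transport hB hA
  have h2 : (H * X * H * transport (H * X * H) (T * X * T)).trace.re
    = fidelity (H * X * H) (T * X * T) := rfl
  set Y := transport (H * X * H) (T * X * T)
  have hu : IsUnit Y.det := (isUnit_iff_isUnit_det _).1 hY.isUnit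
  -- Expanding this square gives `2 F - 2 Re tr (X H T) ≥ 0`, as `Y` attains equality in the duality
  -- for the pair `(H X H, T X T)`.
  have h0 := trace_mul_conj_nonneg hX.posSemidef hY.inv.posSemidef (Y * H - T)
  have e : (Y * H - T)ᴴ * Y⁻¹ * (Y * H - T)
      = H * Y * H - H * T - T * H + T * Y⁻¹ * T := by
    rw [conjTranspose_sub, conjTranspose_mul, hY.1.eq, hT.1.eq, hH.1.eq]
    simp only [Matrix.sub_mul, Matrix.mul_sub]
    rw [mul_nonsing_inv_cancel_right _ _ hu, Matrix.mul_assoc T Y⁻¹,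
      nonsing_inv_mul_cancel_left _ _ hu, Matrix.mul_assoc H Y]
    abel
  have e3 : (X * (T * H)).trace.re = (X * H * T).trace.re := by
    have : (X * (T * H)).trace = star (X * H * T).trace := by
      rw [← trace_conjTranspose, conjTranspose_mul, conjTranspose_mul, hX.1.eq, hT.1.eq, hH.1.eq,
        Matrix.trace_mul_comm X, Matrix.mul_assoc]
    rw [this]; simp
  rw [e] at h0
  simp only [Matrix.mul_add, Matrix.mul_sub, trace_add, trace_sub, Complex.add_re,
    Complex.sub_re] at h0
  rw [trace_mul_conj, trace_mul_conj, e3, ← Matrix.mul_assoc, h1, h2] at h0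
  linarith

theorem dist_sq {X A : Matrix (Fin n) (Fin n) ℂ} (hX : X.PosDef) (hA : A.PosDef) :
    dist X A ^ 2 = X.trace.re + A.trace.re - 2 * fidelity X A := by
  -- The test matrix `1` shows that the radicand in `dist` is nonnegative.
  have h := two_mul_fidelity_le hX hA PosDef.one
  rw [inv_one, Matrix.mul_one, Matrix.mul_one] at h
  have e : fidelity X A = (CFC.sqrt (CFC.sqrt X * A * CFC.sqrt X)).trace.re := by
    rw [fidelity, trace_mul_transport hX]
  rw [dist, Real.sq_sqrt] <;> rw [← e]
  linarith

/-! ### Variance, mean transport and the map `K`. -/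

/-- The weighted mean of the transport maps from `X` to the `A j`. -/
def meanTransport (w : Fin m → ℝ) (A : Fin m → Matrix (Fin n) (Fin n) ℂ)
    (X : Matrix (Fin n) (Fin n) ℂ) : Matrix (Fin n) (Fin n) ℂ :=
  ∑ j, w j • transport X (A j)

theorem nonempty_of_sum_eq_one {w : Fin m → ℝ} (hw1 : ∑ j, w j = 1) : Nonempty (Fin m) := by
  by_contra h
  rw [not_nonempty_iff] at h
  simp at hw1

theorem posDef_sum_smul {w : Fin m → ℝ} (hw : ∀ j, 0 < w j) (hw1 : ∑ j, w j = 1)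
    {B : Fin m → Matrix (Fin n) (Fin n) ℂ} (hB : ∀ j, (B j).PosDef) :
    (∑ j, w j • B j).PosDef := by
  obtain ⟨j⟩ := nonempty_of_sum_eq_one hw1
  exact posDef_sum ⟨j, Finset.mem_univ j⟩ fun j _ => (hB j).smul (hw j)

theorem trace_mul_sum_smul_re (w : Fin m → ℝ) (X : Matrix (Fin n) (Fin n) ℂ)
    (B : Fin m → Matrix (Fin n) (Fin n) ℂ) :
    (X * ∑ j, w j • B j).trace.re = ∑ j, w j * (X * B j).trace.re := by
  simp [Matrix.mul_sum, trace_sum, trace_smul]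

section

variable {w : Fin m → ℝ} {A : Fin m → Matrix (Fin n) (Fin n) ℂ}
  {X Y : Matrix (Fin n) (Fin n) ℂ}

theorem posDef_meanTransport (hw : ∀ j, 0 < w j) (hw1 : ∑ j, w j = 1) (hA : ∀ j, (A j).PosDef)
    (hX : X.PosDef) : (meanTransport w A X).PosDef :=
  posDef_sum_smul hw hw1 fun j => posDef_transport hX (hA j)

theorem trace_mul_meanTransport_re (w : Fin m → ℝ) (A : Fin m → Matrix (Fin n) (Fin n) ℂ)
    (X : Matrix (Fin n) (Fin n) ℂ) :
    (X * meanTransport w A X).trace.re = ∑ j, w j * fidelity X (A j) :=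
  trace_mul_sum_smul_re w X _

theorem meanTransport_eq (w : Fin m → ℝ) (A : Fin m → Matrix (Fin n) (Fin n) ℂ)
    (X : Matrix (Fin n) (Fin n) ℂ) : meanTransport w A X = (CFC.sqrt X)⁻¹ *
      (∑ j, w j • CFC.sqrt (CFC.sqrt X * A j * CFC.sqrt X)) * (CFC.sqrt X)⁻¹ := by
  simp [meanTransport, transport, Matrix.mul_sum, Matrix.sum_mul]

theorem K_eq (hX : X.PosDef) : K w A X = meanTransport w A X * X * meanTransport w A X := by
  rw [meanTransport_eq, K, sq]
  have e := inv_sqrt_mul_mul_inv_sqrt hX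
  set R := CFC.sqrt X
  set M := ∑ j, w j • CFC.sqrt (R * A j * R)
  calc R⁻¹ * (M * M) * R⁻¹ = R⁻¹ * M * (R⁻¹ * X * R⁻¹) * M * R⁻¹ := by
        rw [e]; simp only [Matrix.mul_assoc, Matrix.one_mul]
    _ = _ := by simp only [Matrix.mul_assoc]

theorem posDef_K (hw : ∀ j, 0 < w j) (hw1 : ∑ j, w j = 1) (hA : ∀ j, (A j).PosDef)
    (hX : X.PosDef) : (K w A X).PosDef := by
  rw [K_eq hX]
  exact posDef_conj hX (posDef_meanTransport hw hw1 hA hX)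

theorem variance_eq (hw1 : ∑ j, w j = 1) (hA : ∀ j, (A j).PosDef) (hX : X.PosDef) :
    variance w A X = X.trace.re + ∑ j, w j * (A j).trace.re
      - 2 * (X * meanTransport w A X).trace.re := by
  simp only [variance, dist_sq hX (hA _), trace_mul_meanTransport_re, mul_sub, mul_add,
    Finset.sum_sub_distrib, Finset.sum_add_distrib, ← Finset.sum_mul, hw1, one_mul,
    Finset.mul_sum]
  congr 1
  exact Finset.sum_congr rfl fun j _ => by ring

theorem variance_nonneg (hw : ∀ j, 0 < w j) (X : Matrix (Fin n) (Fin n) ℂ) :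
    0 ≤ variance w A X :=
  Finset.sum_nonneg fun j _ => mul_nonneg (hw j).le (sq_nonneg _)

/-- `tr X (1 - H)²`, where `H` is the mean transport map at `X`. -/
def defect (w : Fin m → ℝ) (A : Fin m → Matrix (Fin n) (Fin n) ℂ)
    (X : Matrix (Fin n) (Fin n) ℂ) : ℝ :=
  X.trace.re + (K w A X).trace.re - 2 * (X * meanTransport w A X).trace.re

theorem defect_eq (hw : ∀ j, 0 < w j) (hw1 : ∑ j, w j = 1) (hA : ∀ j, (A j).PosDef)
    (hX : X.PosDef) : defect w A X
      = (X * ((1 - meanTransport w A X)ᴴ * 1 * (1 - meanTransport w A X))).trace.re := by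
  have h := trace_dual_gap (X := X) (posDef_meanTransport hw hw1 hA hX).1 PosDef.one
  rw [inv_one, Matrix.mul_one, Matrix.mul_one] at h
  rw [← h, defect, K_eq hX]

theorem defect_nonneg (hw : ∀ j, 0 < w j) (hw1 : ∑ j, w j = 1) (hA : ∀ j, (A j).PosDef)
    (hX : X.PosDef) : 0 ≤ defect w A X := by
  rw [defect_eq hw hw1 hA hX]
  exact trace_mul_conj_nonneg hX.posSemidef PosSemidef.one _

theorem meanTransport_eq_one_of_defect_eq_zero (hw : ∀ j, 0 < w j) (hw1 : ∑ j, w j = 1)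
    (hA : ∀ j, (A j).PosDef) (hX : X.PosDef) (h : defect w A X = 0) :
    meanTransport w A X = 1 := by
  rw [defect_eq hw hw1 hA hX] at h
  exact (sub_eq_zero.1 (eq_zero_of_trace_mul_conj_eq_zero hX PosDef.one h)).symm

theorem variance_K_le (hw : ∀ j, 0 < w j) (hw1 : ∑ j, w j = 1) (hA : ∀ j, (A j).PosDef)
    (hX : X.PosDef) :
    variance w A (K w A X) ≤ ∑ j, w j * (A j).trace.re - (K w A X).trace.re := by
  rw [variance_eq hw1 hA (posDef_K hw hw1 hA hX), trace_mul_meanTransport_re]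
  have hH := posDef_meanTransport hw hw1 hA hX
  have h1 : (X * meanTransport w A X * meanTransport w A X).trace.re
      ≤ ∑ j, w j * fidelity (K w A X) (A j) := by
    nth_rw 2 [meanTransport]
    rw [trace_mul_sum_smul_re, K_eq hX]
    refine Finset.sum_le_sum fun j _ => mul_le_mul_of_nonneg_left ?_ (hw j).le
    have := le_fidelity_conj hX hH (posDef_transport hX (hA j))
    rwa [transport_mul_mul_transport hX (hA j)] at this
  have h2 : (X * meanTransport w A X * meanTransport w A X).trace = (K w A X).trace := by
    rw [K_eq hX, trace_mul_cycle]
  rw [h2] at h1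
  linarith

theorem variance_K_add_defect_le (hw : ∀ j, 0 < w j) (hw1 : ∑ j, w j = 1)
    (hA : ∀ j, (A j).PosDef) (hX : X.PosDef) :
    variance w A (K w A X) + defect w A X ≤ variance w A X := by
  have := variance_K_le hw hw1 hA hX
  rw [variance_eq hw1 hA hX, defect]
  linarith

theorem trace_K_le (hw : ∀ j, 0 < w j) (hw1 : ∑ j, w j = 1) (hA : ∀ j, (A j).PosDef)
    (hX : X.PosDef) : (K w A X).trace.re ≤ ∑ j, w j * (A j).trace.re := by
  have := variance_K_le hw hw1 hA hX
  have := variance_nonneg (A := A) hw (K w A X)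
  linarith

/-- Nonnegativity of the defect at `K X` bounds `V(K X)` below by `C - tr (K (K X))`, while
`variance_K_le` bounds it above by `C - tr (K X)`. -/
theorem trace_K_le_trace_K_K (hw : ∀ j, 0 < w j) (hw1 : ∑ j, w j = 1)
    (hA : ∀ j, (A j).PosDef) (hX : X.PosDef) :
    (K w A X).trace.re ≤ (K w A (K w A X)).trace.re := by
  have hK := posDef_K hw hw1 hA hX
  have h1 := variance_K_le hw hw1 hA hX
  rw [variance_eq hw1 hA hK] at h1
  have h2 := defect_nonneg hw hw1 hA hK
  rw [defect] at h2
  linarith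

theorem variance_of_meanTransport_eq_one (hw1 : ∑ j, w j = 1) (hA : ∀ j, (A j).PosDef)
    (hX : X.PosDef) (h : meanTransport w A X = 1) :
    variance w A X = ∑ j, w j * (A j).trace.re - X.trace.re := by
  rw [variance_eq hw1 hA hX, h, Matrix.mul_one]
  ring

/-- The condition `∑ w j T j = 1` splits `tr Y` over `j`, so each bracket is a duality gap at the
test matrix `T j`. -/
theorem variance_sub_variance (hw1 : ∑ j, w j = 1) (hA : ∀ j, (A j).PosDef) (hX : X.PosDef)
    (h : meanTransport w A X = 1) (hY : Y.PosDef) :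
    variance w A Y - variance w A X = ∑ j, w j * ((Y * transport X (A j)).trace.re
      + (A j * (transport X (A j))⁻¹).trace.re - 2 * fidelity Y (A j)) := by
  have e1 : ∑ j, w j * (Y * transport X (A j)).trace.re = Y.trace.re := by
    rw [← trace_mul_sum_smul_re]
    change (Y * meanTransport w A X).trace.re = _
    rw [h, Matrix.mul_one]
  have e2 : ∑ j, w j * (A j * (transport X (A j))⁻¹).trace.re = X.trace.re := by
    simp only [trace_mul_inv_transport hX (hA _), ← trace_mul_meanTransport_re, h,
      Matrix.mul_one]
  rw [variance_of_meanTransport_eq_one hw1 hA hX h, variance_eq hw1 hA hY,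
    trace_mul_meanTransport_re]
  simp only [mul_sub, mul_add, Finset.sum_sub_distrib, Finset.sum_add_distrib, e1, e2,
    mul_left_comm _ (2 : ℝ), ← Finset.mul_sum]
  ring

theorem variance_le_variance (hw : ∀ j, 0 < w j) (hw1 : ∑ j, w j = 1) (hA : ∀ j, (A j).PosDef)
    (hX : X.PosDef) (h : meanTransport w A X = 1) (hY : Y.PosDef) :
    variance w A X ≤ variance w A Y := by
  rw [← sub_nonneg, variance_sub_variance hw1 hA hX h hY]
  exact Finset.sum_nonneg fun j _ => mul_nonneg (hw j).le
    (sub_nonneg.2 (two_mul_fidelity_le hY (hA j) (posDef_transport hX (hA j))))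

theorem eq_of_conj_eq {T : Matrix (Fin n) (Fin n) ℂ} (hT : T.PosDef) (h : T * X * T = T * Y * T) :
    X = Y := by
  have hu := hT.isUnit
  exact hu.mul_left_cancel (hu.mul_right_cancel h)

theorem eq_of_variance_eq (hw : ∀ j, 0 < w j) (hw1 : ∑ j, w j = 1) (hA : ∀ j, (A j).PosDef)
    (hX : X.PosDef) (h : meanTransport w A X = 1) (hY : Y.PosDef)
    (hV : variance w A Y = variance w A X) : Y = X := by
  have e := variance_sub_variance hw1 hA hX h hY
  rw [hV, sub_self, eq_comm, Finset.sum_eq_zero_iff_of_nonneg fun j _ => mul_nonneg (hw j).le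
    (sub_nonneg.2 (two_mul_fidelity_le hY (hA j) (posDef_transport hX (hA j))))] at e
  obtain ⟨j⟩ := nonempty_of_sum_eq_one hw1
  have hj := (mul_eq_zero.1 (e j (Finset.mem_univ j))).resolve_left (hw j).ne'
  have hT := posDef_transport hX (hA j)
  -- A single index suffices: the same `T` carries both `X` and `Y` to `A j`, and conjugation by `T`
  -- is injective.
  have hT' := eq_transport_of_two_mul_fidelity_eq hY (hA j) hT (sub_eq_zero.1 hj).symm
  refine eq_of_conj_eq hT ?_
  rw [transport_mul_mul_transport hX (hA j), hT', transport_mul_mul_transport hY (hA j)]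

theorem isBarycentre_iff (hw : ∀ j, 0 < w j) (hw1 : ∑ j, w j = 1) (hA : ∀ j, (A j).PosDef)
    (hX : X.PosDef) (h : meanTransport w A X = 1) (Y : Matrix (Fin n) (Fin n) ℂ) :
    IsBarycentre w A Y ↔ Y = X := by
  constructor
  · rintro ⟨hY, hmin⟩
    exact eq_of_variance_eq hw hw1 hA hX h hY
      ((hmin X hX).antisymm (variance_le_variance hw hw1 hA hX h hY))
  · rintro rfl
    exact ⟨hX, fun Z hZ => variance_le_variance hw hw1 hA hX h hZ⟩

theorem trace_K_le_trace (hw : ∀ j, 0 < w j) (hw1 : ∑ j, w j = 1) (hA : ∀ j, (A j).PosDef)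
    (hX : X.PosDef) (h : meanTransport w A X = 1) (hY : Y.PosDef) :
    (K w A Y).trace.re ≤ X.trace.re := by
  have h1 := variance_le_variance hw hw1 hA hX h (posDef_K hw hw1 hA hY)
  rw [variance_of_meanTransport_eq_one hw1 hA hX h] at h1
  have := variance_K_le hw hw1 hA hY
  linarith

end

/-! ### Determinant lower bound. -/

theorem one_le_norm_det_one_add {Q : Matrix (Fin n) (Fin n) ℂ} (hQ : Q.PosSemidef) :
    1 ≤ ‖(1 + Q).det‖ := by
  have hM : (1 + Q).PosSemidef := PosSemidef.one.add hQ
  have h1 : (1 : Matrix (Fin n) (Fin n) ℂ) ≤ 1 + Q := by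
    rw [le_iff, add_sub_cancel_left]; exact hQ
  have h2 := (CFC.one_le_iff (R := ℝ) (1 + Q) hM.1).1 h1
  rw [hM.1.det_eq_prod_eigenvalues, norm_prod]
  refine Finset.one_le_prod fun i _ => ?_
  have h3 := h2 _ (hM.1.eigenvalues_mem_spectrum_real i)
  simpa using h3.trans (le_abs_self _)

theorem norm_det_le_norm_det_add {B P : Matrix (Fin n) (Fin n) ℂ} (hB : B.PosDef)
    (hP : P.PosSemidef) : ‖B.det‖ ≤ ‖(B + P).det‖ := by
  have hR := posDef_sqrt hB
  have hu := isUnit_det_sqrt hB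
  set R := CFC.sqrt B with hRdef
  have hQ : (R⁻¹ * P * R⁻¹).PosSemidef := by
    have := hP.conjTranspose_mul_mul_same R⁻¹
    rwa [hR.inv.1.eq] at this
  have hRR : R * R = B := sqrt_mul_sqrt hB.posSemidef
  have e : B + P = R * (1 + R⁻¹ * P * R⁻¹) * R := by
    rw [Matrix.mul_add, Matrix.add_mul, Matrix.mul_one, hRR, Matrix.mul_assoc R⁻¹,
      mul_nonsing_inv_cancel_left _ _ hu, nonsing_inv_mul_cancel_right _ _ hu]
  have h1 := one_le_norm_det_one_add hQ
  rw [e, det_mul, det_mul, ← hRR, det_mul, norm_mul, norm_mul, norm_mul]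
  nlinarith [mul_nonneg (norm_nonneg R.det) (norm_nonneg R.det)]

theorem norm_det_conj_mul (X B : Matrix (Fin n) (Fin n) ℂ) :
    ‖(B * X * B).det‖ = ‖B.det‖ ^ 2 * ‖X.det‖ := by
  rw [det_mul, det_mul, norm_mul, norm_mul]; ring

/-- Since `H ≥ w j T j`, the determinant of `H X H` dominates `w j ^ (2n)` times that of `T j X T j
= A j`. The bound is independent of `X` and keeps cluster points invertible. -/
theorem le_norm_det_K {w : Fin m → ℝ} {A : Fin m → Matrix (Fin n) (Fin n) ℂ}
    {X : Matrix (Fin n) (Fin n) ℂ} (hw : ∀ j, 0 < w j) (hA : ∀ j, (A j).PosDef)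
    (hX : X.PosDef) (j : Fin m) :
    (w j ^ n) ^ 2 * ‖(A j).det‖ ≤ ‖(K w A X).det‖ := by
  have hT := posDef_transport hX (hA j)
  have h1 : ‖(w j • transport X (A j)).det‖ ≤ ‖(meanTransport w A X).det‖ := by
    rw [meanTransport, ← Finset.add_sum_erase _ _ (Finset.mem_univ j)]
    exact norm_det_le_norm_det_add (hT.smul (hw j))
      (posSemidef_sum _ fun i _ => (posDef_transport hX (hA i)).posSemidef.smul (hw i).le)
  have h2 : ‖(w j • transport X (A j)).det‖ = w j ^ n * ‖(transport X (A j)).det‖ := by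
    rw [det_smul_of_tower, norm_smul]
    simp [abs_of_pos (hw j)]
  rw [h2] at h1
  have h3 := pow_le_pow_left₀ (mul_nonneg (pow_nonneg (hw j).le n) (norm_nonneg _)) h1 2
  rw [K_eq hX, norm_det_conj_mul]
  nth_rw 1 [← transport_mul_mul_transport hX (hA j)]
  rw [norm_det_conj_mul, ← mul_assoc, ← mul_pow]
  exact mul_le_mul_of_nonneg_right h3 (norm_nonneg _)

/-! ### Compactness and continuity. -/

open scoped Matrix.Norms.L2Operator in
theorem isClosed_posSemidef : IsClosed {X : Matrix (Fin n) (Fin n) ℂ | X.PosSemidef} := by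
  simp_rw [← nonneg_iff_posSemidef]
  exact CStarAlgebra.isClosed_nonneg

open scoped Matrix.Norms.L2Operator in
theorem continuousOn_sqrt :
    ContinuousOn (CFC.sqrt : Matrix (Fin n) (Fin n) ℂ → _) {X | X.PosSemidef} := by
  refine ContinuousOn.cfcₙ_nnreal_of_mem_nhdsSet (s := Set.univ) NNReal.sqrt Filter.univ_mem
    continuousOn_id (fun x hx => nonneg_iff_posSemidef.2 hx) NNReal.continuous_sqrt.continuousOn

theorem norm_sq_apply_le_trace (B : Matrix (Fin n) (Fin n) ℂ) (i j : Fin n) :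
    ‖B i j‖ ^ 2 ≤ (Bᴴ * B).trace.re := by
  have e : (Bᴴ * B).trace.re = ∑ j, ∑ i, ‖B i j‖ ^ 2 := by
    simp [trace, Matrix.mul_apply, Complex.normSq_eq_norm_sq, ← Complex.normSq_apply]
  rw [e]
  calc ‖B i j‖ ^ 2 ≤ ∑ i, ‖B i j‖ ^ 2 :=
        Finset.single_le_sum (f := fun i => ‖B i j‖ ^ 2) (fun _ _ => sq_nonneg _)
          (Finset.mem_univ i)
    _ ≤ _ := Finset.single_le_sum (f := fun j => ∑ i, ‖B i j‖ ^ 2)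
          (fun _ _ => Finset.sum_nonneg fun _ _ => sq_nonneg _) (Finset.mem_univ j)

/-- Each such `X` is the square of `CFC.sqrt X`, whose entries have squared moduli summing to `tr X
≤ c`; the set is thus closed inside the image of a compact box. -/
theorem isCompact_trace_le_det_ge (c δ : ℝ) :
    IsCompact {X : Matrix (Fin n) (Fin n) ℂ | X.PosSemidef ∧ X.trace.re ≤ c ∧ δ ≤ ‖X.det‖} := by
  have hbox : IsCompact (Set.univ.pi fun _ : Fin n => Set.univ.pi fun _ : Fin n =>
      Metric.closedBall (0 : ℂ) (Real.sqrt c)) :=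
    isCompact_univ_pi fun _ => isCompact_univ_pi fun _ => isCompact_closedBall _ _
  have himage := hbox.image (f := fun B : Matrix (Fin n) (Fin n) ℂ => B * B)
    (continuous_id.matrix_mul continuous_id)
  refine himage.of_isClosed_subset ?_ ?_
  · refine isClosed_posSemidef.inter (IsClosed.inter ?_ ?_)
    · exact isClosed_le (Complex.continuous_re.comp continuous_id.matrix_trace) continuous_const
    · exact isClosed_le continuous_const continuous_id.matrix_det.norm
  · rintro X ⟨hX, hc, -⟩
    refine ⟨CFC.sqrt X, ?_, sqrt_mul_sqrt hX⟩
    refine Set.mem_univ_pi.2 fun i => Set.mem_univ_pi.2 fun j => mem_closedBall_zero_iff.2 ?_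
    refine Real.le_sqrt_of_sq_le ((norm_sq_apply_le_trace _ i j).trans ?_)
    have hR : (CFC.sqrt X).PosSemidef := nonneg_iff_posSemidef.1 (CFC.sqrt_nonneg X)
    rwa [hR.1.eq, sqrt_mul_sqrt hX]

section

variable {w : Fin m → ℝ} {A : Fin m → Matrix (Fin n) (Fin n) ℂ}

theorem continuousOn_inv_sqrt :
    ContinuousOn (fun X : Matrix (Fin n) (Fin n) ℂ => (CFC.sqrt X)⁻¹) {X | X.PosDef} := by
  intro X hX
  have h1 : ContinuousAt Inv.inv (CFC.sqrt X) := by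
    refine continuousAt_matrix_inv _ ?_
    rw [Ring.inverse_eq_inv']
    exact continuousAt_inv₀ (isUnit_det_sqrt hX).ne_zero
  exact h1.comp_continuousWithinAt
    ((continuousOn_sqrt.mono fun Y (hY : Y.PosDef) => hY.posSemidef) X hX)

theorem continuousOn_transport {B : Matrix (Fin n) (Fin n) ℂ} (hB : B.PosDef) :
    ContinuousOn (fun X => transport X B) {X | X.PosDef} := by
  have h1 : ContinuousOn (fun X : Matrix (Fin n) (Fin n) ℂ => CFC.sqrt X) {X | X.PosDef} :=
    continuousOn_sqrt.mono fun Y (hY : Y.PosDef) => hY.posSemidef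
  have h2 : ContinuousOn (fun X => CFC.sqrt (CFC.sqrt X * B * CFC.sqrt X)) {X | X.PosDef} :=
    continuousOn_sqrt.comp ((h1.mul continuousOn_const).mul h1)
      fun X hX => (posDef_conj hB (posDef_sqrt hX)).posSemidef
  exact (continuousOn_inv_sqrt.mul h2).mul continuousOn_inv_sqrt

theorem continuousOn_meanTransport (hA : ∀ j, (A j).PosDef) :
    ContinuousOn (meanTransport w A) {X | X.PosDef} :=
  continuousOn_finsetSum _ fun j _ =>
    (continuous_const_smul (w j)).comp_continuousOn (continuousOn_transport (hA j))

theorem continuousOn_defect (hA : ∀ j, (A j).PosDef) :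
    ContinuousOn (defect w A) {X | X.PosDef} := by
  have hH := continuousOn_meanTransport (w := w) hA
  have htr : Continuous fun X : Matrix (Fin n) (Fin n) ℂ => X.trace.re :=
    Complex.continuous_re.comp continuous_id.matrix_trace
  have hK : ContinuousOn (K w A) {X | X.PosDef} :=
    ((hH.mul continuousOn_id).mul hH).congr fun X hX => K_eq hX
  exact (htr.continuousOn.add (htr.comp_continuousOn hK)).sub
    ((htr.comp_continuousOn (continuousOn_id.mul hH)).const_mul 2)

/-! ### Convergence of the iteration. -/

open Filter Topology

theorem tendsto_defect (hw : ∀ j, 0 < w j) (hw1 : ∑ j, w j = 1) (hA : ∀ j, (A j).PosDef)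
    {S : ℕ → Matrix (Fin n) (Fin n) ℂ} (hS : ∀ k, (S k).PosDef)
    (hK : ∀ k, S (k + 1) = K w A (S k)) :
    Tendsto (fun k => defect w A (S k)) atTop (𝓝 0) := by
  have hle : ∀ k, variance w A (S (k + 1)) + defect w A (S k) ≤ variance w A (S k) := fun k => by
    rw [hK]; exact variance_K_add_defect_le hw hw1 hA (hS k)
  have h0 : ∀ k, 0 ≤ defect w A (S k) := fun k => defect_nonneg hw hw1 hA (hS k)
  have hanti : Antitone fun k => variance w A (S k) :=
    antitone_nat_of_succ_le fun k => by linarith [hle k, h0 k]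
  have hlim := tendsto_atTop_ciInf hanti ⟨0, by rintro _ ⟨k, rfl⟩; exact variance_nonneg hw _⟩
  have hdiff := hlim.sub (hlim.comp (tendsto_add_atTop_nat 1))
  -- The variances decrease to a limit, so their consecutive differences, which dominate the
  -- defects, tend to `0`.
  rw [sub_self] at hdiff
  exact squeeze_zero h0 (fun k => by simpa using by linarith [hle k]) hdiff

theorem exists_subseq_tendsto (hw : ∀ j, 0 < w j) (hw1 : ∑ j, w j = 1)
    (hA : ∀ j, (A j).PosDef) {S : ℕ → Matrix (Fin n) (Fin n) ℂ} (hS : ∀ k, (S k).PosDef)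
    (hK : ∀ k, S (k + 1) = K w A (S k)) {u : ℕ → ℕ} (hu : Tendsto u atTop atTop)
    (hu1 : ∀ k, 1 ≤ u k) :
    ∃ Ω : Matrix (Fin n) (Fin n) ℂ, Ω.PosDef ∧ meanTransport w A Ω = 1 ∧
      ∃ v : ℕ → ℕ, StrictMono v ∧ Tendsto (fun k => S (u (v k))) atTop (𝓝 Ω) := by
  obtain ⟨j⟩ := nonempty_of_sum_eq_one hw1
  have hmem : ∀ k, S (u k) ∈ {X : Matrix (Fin n) (Fin n) ℂ | X.PosSemidef ∧
      X.trace.re ≤ ∑ j, w j * (A j).trace.re ∧ (w j ^ n) ^ 2 * ‖(A j).det‖ ≤ ‖X.det‖} := by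
    intro k
    obtain ⟨i, hi⟩ := Nat.exists_eq_add_of_le' (hu1 k)
    rw [hi, hK]
    exact ⟨(posDef_K hw hw1 hA (hS i)).posSemidef, trace_K_le hw hw1 hA (hS i),
      le_norm_det_K hw hA (hS i) j⟩
  have : FirstCountableTopology (Matrix (Fin n) (Fin n) ℂ) :=
    inferInstanceAs (FirstCountableTopology (Fin n → Fin n → ℂ))
  obtain ⟨Ω, ⟨hΩ, -, hdet⟩, v, hv, hlim⟩ := (isCompact_trace_le_det_ge _ _).tendsto_subseq hmem
  have hpos : 0 < (w j ^ n) ^ 2 * ‖(A j).det‖ :=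
    mul_pos (pow_pos (pow_pos (hw j) _) _) (norm_pos_iff.2 (hA j).det_pos.ne')
  have hΩ' : Ω.PosDef := hΩ.posDef_iff_det_ne_zero.2 (norm_pos_iff.1 (hpos.trans_le hdet))
  refine ⟨Ω, hΩ', ?_, v, hv, hlim⟩
  refine meanTransport_eq_one_of_defect_eq_zero hw hw1 hA hΩ' ?_
  have h1 : Tendsto (fun k => defect w A (S (u (v k)))) atTop (𝓝 (defect w A Ω)) :=
    (continuousOn_defect hA Ω hΩ').tendsto.comp
      (tendsto_nhdsWithin_iff.2 ⟨hlim, Eventually.of_forall fun k => hS _⟩)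
  exact tendsto_nhds_unique h1
    ((tendsto_defect hw hw1 hA hS hK).comp (hu.comp hv.tendsto_atTop))

/-- The iteration itself, started at `1`, supplies the barycentre as a cluster point. -/
theorem exists_meanTransport_eq_one (hw : ∀ j, 0 < w j) (hw1 : ∑ j, w j = 1)
    (hA : ∀ j, (A j).PosDef) :
    ∃ Ω : Matrix (Fin n) (Fin n) ℂ, Ω.PosDef ∧ meanTransport w A Ω = 1 := by
  have hS : ∀ k, ((K w A)^[k] 1).PosDef := by
    intro k
    induction k with
    | zero => exact PosDef.one
    | succ k ih => rw [Function.iterate_succ_apply']; exact posDef_K hw hw1 hA ih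
  obtain ⟨Ω, h1, h2, -⟩ := exists_subseq_tendsto hw hw1 hA hS
    (fun k => Function.iterate_succ_apply' _ _ _) (tendsto_add_atTop_nat 1)
    (fun k => Nat.le_add_left 1 k)
  exact ⟨Ω, h1, h2⟩

theorem tendsto_of_meanTransport_eq_one (hw : ∀ j, 0 < w j) (hw1 : ∑ j, w j = 1)
    (hA : ∀ j, (A j).PosDef) {Ω : Matrix (Fin n) (Fin n) ℂ} (hΩ : Ω.PosDef)
    (hH : meanTransport w A Ω = 1) {S : ℕ → Matrix (Fin n) (Fin n) ℂ}
    (hS : ∀ k, (S k).PosDef) (hK : ∀ k, S (k + 1) = K w A (S k)) :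
    Tendsto S atTop (𝓝 Ω) := by
  -- The trace and determinant bounds hold only for values of `K`, hence the shift past `S 0`.
  rw [← tendsto_add_atTop_iff_nat 1]
  refine tendsto_of_subseq_tendsto fun u hu => ?_
  obtain ⟨Ω', hΩ', hH', v, -, hlim⟩ := exists_subseq_tendsto hw hw1 hA hS hK
    (u := fun k => u k + 1) ((tendsto_add_atTop_nat 1).comp hu) (fun k => Nat.le_add_left 1 _)
  have h1 := (isBarycentre_iff hw hw1 hA hΩ' hH' Ω').2 rfl
  rw [isBarycentre_iff hw hw1 hA hΩ hH] at h1
  exact ⟨v, h1 ▸ hlim⟩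

end

end BuresWasserstein

end

theorem theorem11 {n m : ℕ} (w : Fin m → ℝ) (hw : ∀ j, 0 < w j) (hw1 : ∑ j, w j = 1)
    (A : Fin m → Matrix (Fin n) (Fin n) ℂ) (hA : ∀ j, (A j).PosDef) :
    ∃ Ω : Matrix (Fin n) (Fin n) ℂ,
      (∀ X, BuresWasserstein.IsBarycentre w A X ↔ X = Ω) ∧
      ∀ S : ℕ → Matrix (Fin n) (Fin n) ℂ, (S 0).PosDef →
        (∀ k, S (k + 1) = BuresWasserstein.K w A (S k)) →
        (∀ k, (S k).PosDef) ∧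
        Filter.Tendsto S Filter.atTop (nhds Ω) ∧
        ∀ k, 1 ≤ k →
          (S k).trace.re ≤ (S (k + 1)).trace.re ∧ (S (k + 1)).trace.re ≤ Ω.trace.re := by
  obtain ⟨Ω, hΩ, hH⟩ := BuresWasserstein.exists_meanTransport_eq_one hw hw1 hA
  refine ⟨Ω, BuresWasserstein.isBarycentre_iff hw hw1 hA hΩ hH, fun S hS0 hK => ?_⟩
  have hS : ∀ k, (S k).PosDef := by
    intro k
    induction k with
    | zero => exact hS0
    | succ k ih => rw [hK]; exact BuresWasserstein.posDef_K hw hw1 hA ih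
  refine ⟨hS, BuresWasserstein.tendsto_of_meanTransport_eq_one hw hw1 hA hΩ hH hS hK,
    fun k hk => ⟨?_, ?_⟩⟩
  · obtain ⟨i, rfl⟩ := Nat.exists_eq_add_of_le' hk
    rw [hK (i + 1), hK i]
    exact BuresWasserstein.trace_K_le_trace_K_K hw hw1 hA (hS i)
  · rw [hK]
    exact BuresWasserstein.trace_K_le_trace hw hw1 hA hΩ hH (hS k)
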